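/- Let $l \ge 1$ and $r \ge 0$ be integers, and let $M_r = F_r/F_r''$ be the free metabelian group of rank $r$, where $F_r$ is the free group of rank $r$ and $F_r''$ is the second term of its derived series. Let $H$ be a finitely generated subgroup of $M_r$ such that (i) $H$ is $l$-verbally closed in $M_r$: for every $n$, all group words $w_1, \dots, w_l$ in variables $x_1, \dots, x_n$ (without constants) and all $h_1, \dots, h_l \in H$, if the system $w_i(x_1, \dots, x_n) = h_i$ $(i = 1, \dots, l)$ has a solution in $M_r$, then it has a solution in $H$; (ii) $r_{ab}(H) = l+1$, where $r_{ab}(H)$ is the minimal number of generators of the image $HM_r'/M_r'$ of $H$ in the abelianization $M_r/M_r'$. Then $H$ is a retract of $M_r$, that is, there is a homomorphism $\rho : M_r \to H$ with $\rho(h) = h$ for all $h \in H$. -/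

import Mathlib

/-- The free metabelian group `M_r` of rank `r`: the free group on `r` generators modulo the
second term `F''` of its derived series. -/
abbrev FreeMetabelianGroup (r : ℕ) : Type :=
  FreeGroup (Fin r) ⧸ derivedSeries (FreeGroup (Fin r)) 2

/-- `H` is `l`-verbally closed in `G`: every system of `l` split equations
`w_i(x_1, ..., x_n) = h_i` with `h_i ∈ H`, in any finite number `n` of variables, that has a
solution in `G`, has a solution in `H`. -/
def IsLVerballyClosed {G : Type*} [Group G] (l : ℕ) (H : Subgroup G) : Prop :=
  ∀ (n : ℕ) (w : Fin l → FreeGroup (Fin n)) (h : Fin l → H),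
    (∃ x : Fin n → G, ∀ i, FreeGroup.lift x (w i) = (h i : G)) →
      ∃ y : Fin n → H, ∀ i, FreeGroup.lift y (w i) = h i

/-- `H` is a retract of `G`: there is a homomorphism `G → H` that is the identity on `H`. -/
def IsGroupRetract {G : Type*} [Group G] (H : Subgroup G) : Prop :=
  ∃ ρ : G →* H, ∀ h : H, ρ (h : G) = h

/-- The image `HG'/G'` of `H` in `G/G'`. -/
abbrev abImage {G : Type*} [Group G] (H : Subgroup G) : Subgroup (Abelianization G) :=
  H.map Abelianization.of

instance abImage_fg {G : Type*} [Group G] (H : Subgroup G) [Group.FG H] :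
    Group.FG (abImage H) :=
  Group.fg_of_surjective (Abelianization.of.subgroupMap_surjective H)

/-- `r_ab(H)`: the minimal number of generators of `HG'/G'`, for finitely generated `H`. -/
noncomputable def rAb {G : Type*} [Group G] (H : Subgroup G) [Group.FG H] : ℕ :=
  Group.rank (abImage H)

/-!
Write `M` for `M_r`, `Λ` for the group ring `ℤ[ℤ^r]`, and `h̄` for the class of `h` in `ℤ^r`.

Choose `h₁, …, h_{l+1}` in `H` mapping to a `ℤ`-basis of the image `B` of `H` in `ℤ^r`
(`exists_basis`), put `c = h_{l+1}`, and let `g_j = ⁅⁅⁅⁅h_j, c⁆, h_j⁆, h_j⁆, c⁆` for `j ≤ l`. These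
are `l` elements of `H`, so verbal closedness gives a homomorphism `φ : M → H` fixing all of them
(`exists_hom_fixing`). The `g_j` are taken in `M'` because the module `H'` has rank `l`, so that
`l` of its elements can determine an endomorphism on it.

* `φ` induces `±1` on each basis vector `h̄_i` (`ab_eq_or_eq_inv_of_fixes`). Expand Fox derivatives
  in powers of `t` by `a ↦ exp (t ℓ(a))`, where `ℓ` sends the basis of `B` to independent
  variables. The leading coefficient of the derivatives of `⁅⁅⁅⁅u, v⁆, u⁆, u⁆, v⁆` is, up to sign,
  `ℓ(u)² ℓ(v) (ℓ(u) v̄ - ℓ(v) ū)`, and unique factorization recovers `ū` and `v̄` from it up to sign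
  (`linearForm_rigidity`).
* Hence `θ = φ²` acts trivially on `B` and fixes every `g_j`. As `Λ` is a domain, `θ` preserves the
  Fox derivatives of `⁅h_j, c⁆`. The difference `E = fox ∘ θ - fox` is a crossed homomorphism on
  `H`, and so is `Q(h) = (1 - c̄) E(h) - (1 - h̄) E(c)`, which vanishes on all the `h_i`. The `h_i`
  generate `H` modulo `H'`, because `H ∩ M' = H'` by verbal closedness
  (`mem_commutator_of_isLVerballyClosed`). So the `Λ`-span `S` of the values of `Q` satisfies
  `S = I S` with `I` the augmentation ideal, and Nakayama's lemma gives `Q = 0`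
  (`IsCrossedHom.eq_zero_of_augmentation`). Thus `E` vanishes on `H ∩ M'`.
* Fox derivatives embed `M'` into `Λ^r` (the Magnus embedding, `eq_one_of_fox_eq_zero`), so `θ` is
  the identity on `H ∩ M'` as well as on `H / (H ∩ M')`. Therefore `θ` restricts to an automorphism
  of `H`, and its inverse composed with `θ : M → H` is a retraction (`isGroupRetract_of_fixes`).
-/

open scoped commutatorElement

/-! ### Crossed homomorphisms -/

/-- `D : G → V` is a crossed homomorphism (derivation) with respect to `χ : G →* R`, where `g`
acts on the `R`-module `V` as the scalar `χ g`. -/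
def IsCrossedHom {G R V : Type*} [Group G] [CommRing R] [AddCommGroup V] [Module R V]
    (χ : G →* R) (D : G → V) : Prop :=
  ∀ g h, D (g * h) = D g + χ g • D h

namespace IsCrossedHom

variable {G R V : Type*} [Group G] [CommRing R] [AddCommGroup V] [Module R V]
  {χ : G →* R} {D : G → V}

lemma map_one (hD : IsCrossedHom χ D) : D 1 = 0 := by
  have := hD 1 1
  simpa using this

lemma char_commutator (χ : G →* R) (g h : G) : χ ⁅g, h⁆ = 1 := by
  have h1 : χ g * χ g⁻¹ = 1 := by rw [← map_mul, mul_inv_cancel, _root_.map_one]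
  have h2 : χ h * χ h⁻¹ = 1 := by rw [← map_mul, mul_inv_cancel, _root_.map_one]
  rw [commutatorElement_def, map_mul, map_mul, map_mul]
  linear_combination (χ h * χ h⁻¹) * h1 + h2

lemma map_commutator (hD : IsCrossedHom χ D) (g h : G) :
    D ⁅g, h⁆ = (1 - χ h) • D g - (1 - χ g) • D h := by
  have e : ⁅g, h⁆ * (h * g) = g * h := by simp [commutatorElement_def, mul_assoc]
  have := hD ⁅g, h⁆ (h * g)
  rw [e, hD, hD, char_commutator, one_smul] at this
  rw [eq_sub_of_add_eq this.symm]
  module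

lemma map_commutator_left (hD : IsCrossedHom χ D) {c : G} (hc : χ c = 1) (h : G) :
    D ⁅c, h⁆ = (1 - χ h) • D c := by
  rw [hD.map_commutator, hc]; simp

lemma map_inv_mul (hD : IsCrossedHom χ D) (g h : G) : χ g • D (g⁻¹ * h) = D h - D g := by
  have := hD g (g⁻¹ * h)
  rw [mul_inv_cancel_left] at this
  rw [this]; abel

/-- If two elements agree under `χ` and under `D`, their quotient is killed by `D`. -/
lemma map_inv_mul_eq_zero (hD : IsCrossedHom χ D) {g h : G} (e : D g = D h) :
    D (g⁻¹ * h) = 0 := by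
  have h1 : χ g⁻¹ * χ g = 1 := by rw [← map_mul, inv_mul_cancel, _root_.map_one]
  have := congrArg (χ g⁻¹ • ·) (hD.map_inv_mul g h)
  simpa [smul_smul, h1, e] using this

lemma comp {G' : Type*} [Group G'] (hD : IsCrossedHom χ D) (f : G' →* G) :
    IsCrossedHom (χ.comp f) (D ∘ f) := by
  intro g h
  simp [hD (f g) (f h)]

lemma eqOn_closure_zero (hD : IsCrossedHom χ D) {s : Set G} (hs : ∀ g ∈ s, D g = 0) {g : G}
    (hg : g ∈ Subgroup.closure s) : D g = 0 := by
  induction hg using Subgroup.closure_induction with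
  | mem x hx => exact hs x hx
  | one => exact hD.map_one
  | mul x y _ _ hx hy => rw [hD, hx, hy]; simp
  | inv x _ hx =>
    have := hD.map_inv_mul_eq_zero (g := x) (h := 1) (by rw [hx, hD.map_one])
    simpa using this

/-- The commutator `⁅⁅⁅⁅u, v⁆, u⁆, u⁆, v⁆` is used because the polynomial it contributes, which is
`u² v` times the Koszul form of `u` and `v`, determines `u` and `v` up to sign. -/
lemma map_iterated_commutator (hD : IsCrossedHom χ D) (u v : G) :
    D ⁅⁅⁅⁅u, v⁆, u⁆, u⁆, v⁆ = ((1 - χ v) * (1 - χ u) ^ 2) • D ⁅u, v⁆ := by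
  rw [hD.map_commutator_left (char_commutator _ _ _), hD.map_commutator_left (char_commutator _ _ _),
    hD.map_commutator_left (char_commutator _ _ _), smul_smul, smul_smul]
  congr 1; ring

/-- A Nakayama argument: the span `S` of the values of `D` equals the span of its values on `G'`,
which lie in `I • S` with `I` the kernel of the augmentation `ε`. -/
lemma eq_zero_of_augmentation [IsDomain R] [Module.IsTorsionFree R V] [IsNoetherian R V]
    (hD : IsCrossedHom χ D) (ε : R →+* ℤ) (hε : ∀ g, ε (χ g) = 1) (K : Subgroup G)
    (hK : ∀ k ∈ K, D k = 0) (hgen : ∀ g, ∃ k ∈ K, k⁻¹ * g ∈ commutator G) (g : G) : D g = 0 := by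
  set S : Submodule R V := Submodule.span R (Set.range D) with hS
  have hc : ∀ g ∈ commutator G, χ g = 1 ∧ D g ∈ RingHom.ker ε • S := by
    intro g hg
    rw [commutator_eq_closure] at hg
    induction hg using Subgroup.closure_induction with
    | mem x hx =>
      obtain ⟨a, b, rfl⟩ := hx
      refine ⟨char_commutator _ _ _, ?_⟩
      rw [hD.map_commutator]
      refine sub_mem (Submodule.smul_mem_smul ?_ (Submodule.subset_span ⟨a, rfl⟩))
        (Submodule.smul_mem_smul ?_ (Submodule.subset_span ⟨b, rfl⟩)) <;>
      simp [RingHom.mem_ker, hε]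
    | one => exact ⟨_root_.map_one _, by rw [hD.map_one]; exact zero_mem _⟩
    | mul x y _ _ hx hy =>
      refine ⟨by rw [map_mul, hx.1, hy.1, one_mul], ?_⟩
      rw [hD, hx.1, one_smul]
      exact add_mem hx.2 hy.2
    | inv x _ hx =>
      have h1 : χ x⁻¹ = 1 := by
        have : χ x * χ x⁻¹ = 1 := by rw [← map_mul, mul_inv_cancel, _root_.map_one]
        rwa [hx.1, one_mul] at this
      refine ⟨h1, ?_⟩
      have := hD.map_inv_mul x 1
      rw [hx.1, one_smul, mul_one, hD.map_one, zero_sub] at this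
      rw [this]
      exact neg_mem hx.2
  have hle : S ≤ RingHom.ker ε • S := by
    rw [hS, Submodule.span_le]
    rintro _ ⟨g, rfl⟩
    obtain ⟨k, hk, hkg⟩ := hgen g
    have : D g = χ k • D (k⁻¹ * g) := by rw [hD.map_inv_mul, hK k hk, sub_zero]
    rw [this]
    exact Submodule.smul_mem _ _ (hc _ hkg).2
  obtain ⟨c, hc1, hc2⟩ := Submodule.exists_sub_one_mem_and_smul_eq_zero_of_fg_of_le_smul
    (RingHom.ker ε) S (IsNoetherian.noetherian S) hle
  have hc0 : c ≠ 0 := by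
    rintro rfl
    simp [RingHom.mem_ker] at hc1
  exact (smul_eq_zero.mp (hc2 _ (Submodule.subset_span ⟨g, rfl⟩))).resolve_left hc0

end IsCrossedHom

/-! ### The Magnus embedding of the free metabelian group -/

/-- The free abelian group of rank `r`, written multiplicatively. -/
abbrev FreeAb (r : ℕ) : Type := Multiplicative (Fin r → ℤ)

/-- The integral group ring of the free abelian group of rank `r`, that is, the ring of Laurent
polynomials in `r` variables. -/
abbrev LaurentRing (r : ℕ) : Type := MonoidAlgebra ℤ (FreeAb r)

instance LaurentRing.isNoetherianRing (r : ℕ) : IsNoetherianRing (LaurentRing r) :=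
  Algebra.FiniteType.isNoetherianRing ℤ _

namespace Magnus

variable {r : ℕ}

/-- The exponent-sum homomorphism from `F_r` onto `ℤ^r`. -/
def expSum (r : ℕ) : FreeGroup (Fin r) →* FreeAb r :=
  FreeGroup.lift fun i => Multiplicative.ofAdd (Pi.single i 1)

@[simp] lemma expSum_of (i : Fin r) :
    expSum r (FreeGroup.of i) = Multiplicative.ofAdd (Pi.single i 1) := by
  simp [expSum]

lemma mem_commutator_of_expSum_eq_one {w : FreeGroup (Fin r)} (hw : expSum r w = 1) :
    w ∈ commutator (FreeGroup (Fin r)) := by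
  -- `a ↦ ∏ xᵢ ^ aᵢ` is a left inverse of the map induced on the abelianization.
  let back : FreeAb r →* Abelianization (FreeGroup (Fin r)) :=
    { toFun := fun a => ∏ i, Abelianization.of (FreeGroup.of i) ^ (Multiplicative.toAdd a i)
      map_one' := by simp
      map_mul' := fun a b => by simp [zpow_add, Finset.prod_mul_distrib] }
  have key : back.comp (expSum r) = Abelianization.of := by
    refine FreeGroup.ext_hom _ _ fun i => ?_
    have : ∀ j, Abelianization.of (FreeGroup.of j) ^ ((Pi.single i 1 : Fin r → ℤ) j)
        = if j = i then Abelianization.of (FreeGroup.of i) else 1 := by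
      intro j
      by_cases hj : j = i
      · subst hj; simp
      · simp [hj]
    simp [back, this]
  rw [← Abelianization.ker_of, MonoidHom.mem_ker, ← key]
  simp [hw]

lemma expSum_surjective : Function.Surjective (expSum r) := by
  intro a
  refine ⟨(List.ofFn fun i => FreeGroup.of i ^ (Multiplicative.toAdd a i)).prod, ?_⟩
  rw [map_list_prod, List.map_ofFn, List.prod_ofFn]
  refine Multiplicative.toAdd.injective ?_
  rw [toAdd_prod]
  funext k
  simp [Finset.sum_apply, Pi.single_apply]

/-- The affine permutation `v ↦ a • v + d` of `Λ^r`. -/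
noncomputable def affinePerm (a : FreeAb r) (d : Fin r → LaurentRing r) :
    Equiv.Perm (Fin r → LaurentRing r) where
  toFun v := MonoidAlgebra.of ℤ _ a • v + d
  invFun v := MonoidAlgebra.of ℤ _ a⁻¹ • (v - d)
  left_inv v := by
    simp only [add_sub_cancel_right, smul_smul, ← map_mul, inv_mul_cancel, map_one, one_smul]
  right_inv v := by
    simp only [smul_smul, ← map_mul, mul_inv_cancel, map_one, one_smul, sub_add_cancel]

/-- The Magnus representation of `F_r` by affine permutations of `Λ^r`, in which the generator `xᵢ`
acts as `v ↦ xᵢ v + eᵢ`. -/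
noncomputable def magnus (r : ℕ) : FreeGroup (Fin r) →* Equiv.Perm (Fin r → LaurentRing r) :=
  FreeGroup.lift fun i => affinePerm (Multiplicative.ofAdd (Pi.single i 1)) (Pi.single i 1)

/-- The vector of Fox derivatives of a word, with values in `Λ = ℤ[ℤ^r]`. -/
noncomputable def fox (w : FreeGroup (Fin r)) : Fin r → LaurentRing r := magnus r w 0

lemma magnus_apply (w : FreeGroup (Fin r)) (v : Fin r → LaurentRing r) :
    magnus r w v = MonoidAlgebra.of ℤ _ (expSum r w) • v + fox w := by
  induction w using FreeGroup.induction_on generalizing v with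
  | C1 => simp only [fox, map_one, Equiv.Perm.one_apply, one_smul, add_zero]
  | of i => simp [fox, magnus, affinePerm]
  | inv_of i hi =>
    have h : ∀ v, magnus r (FreeGroup.of i)⁻¹ v =
        MonoidAlgebra.of ℤ _ (expSum r (FreeGroup.of i))⁻¹ • (v - Pi.single i 1) := by
      intro v
      rw [map_inv, magnus, FreeGroup.lift_apply_of, expSum_of]
      rfl
    rw [fox, h, h, map_inv (expSum r), zero_sub, smul_sub, smul_neg, sub_eq_add_neg]
  | mul x y hx hy =>
    simp only [fox] at hx hy ⊢
    rw [map_mul, Equiv.Perm.mul_apply, Equiv.Perm.mul_apply, hy, hx, hx (magnus r y 0), map_mul,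
      map_mul, smul_add, smul_smul, add_assoc]

lemma isCrossedHom_fox :
    IsCrossedHom ((MonoidAlgebra.of ℤ (FreeAb r)).comp (expSum r)) (fox (r := r)) := by
  intro g h
  rw [fox, map_mul, Equiv.Perm.mul_apply, magnus_apply, add_comm]
  rfl

lemma fox_of (i : Fin r) : fox (FreeGroup.of i) = Pi.single i 1 := by
  simp [fox, magnus, affinePerm]

lemma expSum_eq_one_of_mem_commutator {w : FreeGroup (Fin r)}
    (hw : w ∈ commutator (FreeGroup (Fin r))) : expSum r w = 1 :=
  Abelianization.commutator_subset_ker (expSum r) hw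

/-- Elements of `F'` act by translations, which commute. -/
lemma derivedSeries_two_le_ker_magnus :
    derivedSeries (FreeGroup (Fin r)) 2 ≤ (magnus r).ker := by
  rw [derivedSeries_succ, derivedSeries_one, Subgroup.commutator_le]
  intro g hg h hh
  rw [MonoidHom.mem_ker, map_commutatorElement, commutatorElement_eq_one_iff_mul_comm]
  ext1 v
  rw [Equiv.Perm.mul_apply, Equiv.Perm.mul_apply]
  simp only [magnus_apply, expSum_eq_one_of_mem_commutator hg, expSum_eq_one_of_mem_commutator hh,
    map_one, one_smul]
  abel

/-- A word whose Fox derivatives vanish is traversed as a closed path in the Cayley graph of `ℤ^r`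
that runs through each edge zero times in total. -/
lemma mem_derivedSeries_two_of_fox_eq_zero {w : FreeGroup (Fin r)} (hw : expSum r w = 1)
    (hfox : fox w = 0) : w ∈ derivedSeries (FreeGroup (Fin r)) 2 := by
  -- `s` is a transversal of `F'`, and `t a w` is the loop at the base point which follows
  -- the path labelled `w` from the vertex `a`.
  obtain ⟨s, hs⟩ := (expSum_surjective (r := r)).hasRightInverse
  have ht : ∀ a w, s a * w * (s (a * expSum r w))⁻¹ ∈ commutator (FreeGroup (Fin r)) := by
    intro a w
    apply mem_commutator_of_expSum_eq_one
    rw [map_mul, map_mul, map_inv, hs, hs, mul_inv_cancel]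
  let t : FreeAb r → FreeGroup (Fin r) → Additive (Abelianization (commutator (FreeGroup (Fin r)))) :=
    fun a w => Additive.ofMul (Abelianization.of ⟨_, ht a w⟩)
  have t_mul : ∀ a x y, t a (x * y) = t a x + t (a * expSum r x) y := by
    intro a x y
    have e : (⟨_, ht a (x * y)⟩ : commutator (FreeGroup (Fin r))) =
        ⟨_, ht a x⟩ * ⟨_, ht (a * expSum r x) y⟩ := by
      ext1
      simp [mul_assoc]
    exact congrArg (fun c => Additive.ofMul (Abelianization.of c)) e
  -- The additive map sending an edge `(a, i)` of the Cayley graph to its loop.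
  let τ : (Fin r → LaurentRing r) →+
      Additive (Abelianization (commutator (FreeGroup (Fin r)))) :=
    ∑ i, ((Finsupp.liftAddHom fun a => zmultiplesHom _ (t a (FreeGroup.of i))).comp
      (MonoidAlgebra.coeffAddEquiv (R := ℤ) (M := FreeAb r)).toAddMonoidHom).comp
        (Pi.evalAddMonoidHom (fun _ => LaurentRing r) i)
  have key : ∀ (x : FreeGroup (Fin r)) (a : FreeAb r),
      τ (MonoidAlgebra.of ℤ _ a • fox x) = t a x := by
    have hone : ∀ a, t a 1 = 0 := by
      intro a
      have := t_mul a 1 1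
      simpa using this
    intro x
    induction x using FreeGroup.induction_on with
    | C1 => intro a; rw [isCrossedHom_fox.map_one, smul_zero, map_zero, hone]
    | of i =>
      intro a
      rw [fox_of, AddMonoidHom.finsetSum_apply, Finset.sum_eq_single i]
      · simp
      · intro j _ hj
        simp [hj]
      · simp
    | inv_of i hi =>
      intro a
      have h1 := hi (a * (expSum r (FreeGroup.of i))⁻¹)
      have h2 := isCrossedHom_fox (FreeGroup.of i)⁻¹ (FreeGroup.of i)
      rw [inv_mul_cancel, isCrossedHom_fox.map_one] at h2
      have h3 := t_mul a (FreeGroup.of i)⁻¹ (FreeGroup.of i)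
      rw [inv_mul_cancel, hone, map_inv] at h3
      rw [eq_neg_of_add_eq_zero_left h2.symm, eq_neg_of_add_eq_zero_left h3.symm, smul_neg,
        map_neg, smul_smul, MonoidHom.comp_apply, ← map_mul, map_inv, h1]
    | mul x y hx hy =>
      intro a
      rw [isCrossedHom_fox, smul_add, map_add, hx, smul_smul, MonoidHom.comp_apply, ← map_mul, hy,
        t_mul]
  have h1 := key w 1
  rw [hfox, smul_zero, map_zero] at h1
  have h2 : (⟨_, ht 1 w⟩ : commutator (FreeGroup (Fin r))) ∈ commutator _ := by
    rw [← Abelianization.ker_of (commutator _), MonoidHom.mem_ker]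
    exact Additive.ofMul.injective h1.symm
  have h3 : s 1 * w * (s 1)⁻¹ ∈ derivedSeries (FreeGroup (Fin r)) 2 := by
    have := Subgroup.mem_map_of_mem (commutator (FreeGroup (Fin r))).subtype h2
    rw [commutator_def (commutator _), Subgroup.map_commutator, ← MonoidHom.range_eq_map,
      Subgroup.range_subtype] at this
    simpa [hw, derivedSeries_succ] using this
  have := (derivedSeries_normal (FreeGroup (Fin r)) 2).conj_mem _ h3 (s 1)⁻¹
  simpa [mul_assoc] using this

end Magnus

namespace FreeMetabelianGroup

variable {r : ℕ}

/-- The abelianization map from `M_r` onto `ℤ^r`. -/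
def ab (r : ℕ) : FreeMetabelianGroup r →* FreeAb r :=
  QuotientGroup.lift _ (Magnus.expSum r) fun _ hw =>
    Magnus.expSum_eq_one_of_mem_commutator
      (derivedSeries_antitone _ one_le_two hw)

/-- The derivation `M_r → Λ^r` given by Fox derivatives. -/
noncomputable def fox (m : FreeMetabelianGroup r) : Fin r → LaurentRing r :=
  QuotientGroup.lift _ (Magnus.magnus r) Magnus.derivedSeries_two_le_ker_magnus m 0

/-- The `i`-th standard generator of `M_r`. -/
def gen (i : Fin r) : FreeMetabelianGroup r := QuotientGroup.mk' _ (FreeGroup.of i)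

lemma ab_gen (i : Fin r) : ab r (gen i) = Multiplicative.ofAdd (Pi.single i 1) :=
  Magnus.expSum_of i

lemma fox_gen (i : Fin r) : fox (gen i) = Pi.single i 1 :=
  Magnus.fox_of i

lemma isCrossedHom_fox :
    IsCrossedHom ((MonoidAlgebra.of ℤ (FreeAb r)).comp (ab r)) (fox (r := r)) := by
  intro g h
  induction g using QuotientGroup.induction_on with
  | H g =>
    induction h using QuotientGroup.induction_on with
    | H h => exact Magnus.isCrossedHom_fox g h

lemma ab_eq_one_iff {m : FreeMetabelianGroup r} :
    ab r m = 1 ↔ m ∈ commutator (FreeMetabelianGroup r) := by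
  refine ⟨?_, fun h => Abelianization.commutator_subset_ker (ab r) h⟩
  induction m using QuotientGroup.induction_on with
  | H w =>
    intro h
    have h1 := Subgroup.mem_map_of_mem (QuotientGroup.mk' (derivedSeries (FreeGroup (Fin r)) 2))
      (Magnus.mem_commutator_of_expSum_eq_one (w := w) h)
    rw [commutator_def, Subgroup.map_commutator] at h1
    exact Subgroup.commutator_mono le_top le_top h1

lemma eq_one_of_fox_eq_zero {m : FreeMetabelianGroup r} (hm : ab r m = 1) (hfox : fox m = 0) :
    m = 1 := by
  induction m using QuotientGroup.induction_on with
  | H w =>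
    rw [QuotientGroup.eq_one_iff]
    exact Magnus.mem_derivedSeries_two_of_fox_eq_zero hm hfox

lemma closure_range_gen : Subgroup.closure (Set.range (gen (r := r))) = ⊤ := by
  have : Set.range (gen (r := r)) =
      QuotientGroup.mk' (derivedSeries (FreeGroup (Fin r)) 2) '' Set.range FreeGroup.of := by
    rw [← Set.range_comp]; rfl
  rw [this, ← MonoidHom.map_closure, FreeGroup.closure_range_of, ← MonoidHom.range_eq_map,
    MonoidHom.range_eq_top]
  exact QuotientGroup.mk'_surjective _

lemma derivedSeries_two_eq_bot : derivedSeries (FreeMetabelianGroup r) 2 = ⊥ := by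
  rw [← map_derivedSeries_eq (QuotientGroup.mk'_surjective (derivedSeries (FreeGroup (Fin r)) 2)),
    QuotientGroup.map_mk'_self]

end FreeMetabelianGroup

/-! ### Endomorphisms fixing a full-rank family of commutators -/

namespace FreeMetabelianGroup

variable {r : ℕ}

lemma eq_of_fox_eq {x y : FreeMetabelianGroup r} (hab : ab r x = ab r y) (hfox : fox x = fox y) :
    x = y := by
  have h1 : ab r (x⁻¹ * y) = 1 := by rw [map_mul, map_inv, hab, inv_mul_cancel]
  exact inv_mul_eq_one.mp
    (eq_one_of_fox_eq_zero h1 (isCrossedHom_fox.map_inv_mul_eq_zero hfox))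

/-- Let `θ` act trivially on the image of `H` in `ℤ^r`, and let `fox` take equal values on `⁅x, c⁆`
and `θ ⁅x, c⁆` for `x` in a set generating `H` modulo `H'`. Then `θ` fixes `H ∩ M'`: with
`E = fox ∘ θ - fox`, the crossed homomorphism `h ↦ (1 - c) E(h) - (1 - h) E(c)` on `H` vanishes on
that set, hence everywhere. -/
lemma fixes_of_fixes_commutators (H : Subgroup (FreeMetabelianGroup r))
    (hN : ∀ x : H, ab r x = 1 → x ∈ commutator H) (s : Set H) (c : H)
    (hgen : ∀ x : H, ∃ k ∈ Subgroup.closure s, ab r k = ab r x) (hc : ab r c ≠ 1)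
    (θ : FreeMetabelianGroup r →* FreeMetabelianGroup r)
    (hθ : ∀ x : H, ab r (θ x) = ab r x)
    (hfix : ∀ x ∈ s, fox (θ ⁅(x : FreeMetabelianGroup r), (c : FreeMetabelianGroup r)⁆) =
      fox ⁅(x : FreeMetabelianGroup r), (c : FreeMetabelianGroup r)⁆)
    (x : H) (hx : ab r x = 1) : θ x = x := by
  set χ : H →* LaurentRing r := ((MonoidAlgebra.of ℤ (FreeAb r)).comp (ab r)).comp H.subtype with hχ
  have hD : IsCrossedHom χ (fun y : H => fox (y : FreeMetabelianGroup r)) :=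
    isCrossedHom_fox.comp H.subtype
  have hDθ : IsCrossedHom χ (fun y : H => fox (θ y)) := by
    intro g h
    have := isCrossedHom_fox (θ g) (θ h)
    rw [← map_mul] at this
    simp only [MonoidHom.comp_apply, hθ] at this
    exact this
  let E : H → Fin r → LaurentRing r := fun y => fox (θ y) - fox (y : FreeMetabelianGroup r)
  have hE : IsCrossedHom χ E := by
    intro g h
    have h1 : fox (g * h : H).1 = fox g.1 + χ g • fox h.1 := hD g h
    have h2 : fox (θ (g * h : H)) = fox (θ g) + χ g • fox (θ h) := hDθ g h
    simp only [E]
    rw [h1, h2]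
    module
  let Q : H → Fin r → LaurentRing r := fun y => (1 - χ c) • E y - (1 - χ y) • E c
  have hQ : IsCrossedHom χ Q := by
    intro g h
    simp only [Q]
    rw [hE g h, map_mul]
    module
  have hQs : ∀ y ∈ s, Q y = 0 := by
    intro y hy
    have h1 : Q y = E ⁅y, c⁆ := (hE.map_commutator y c).symm
    rw [h1]
    simp only [E, sub_eq_zero]
    exact hfix y hy
  have hQ0 := hQ.eq_zero_of_augmentation
    (MonoidAlgebra.lift ℤ ℤ (FreeAb r) 1).toRingHom (fun g => by simp [hχ])
    (Subgroup.closure s) (fun k hk => hQ.eqOn_closure_zero hQs hk) (fun g => by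
      obtain ⟨k, hk, hkg⟩ := hgen g
      refine ⟨k, hk, hN _ ?_⟩
      rw [Subgroup.coe_mul, Subgroup.coe_inv, map_mul, map_inv, hkg, inv_mul_cancel]) x
  have hχx : χ x = 1 := by
    change MonoidAlgebra.of ℤ _ (ab r x) = 1
    rw [hx, map_one]
  simp only [Q, hχx, sub_self, zero_smul, sub_zero] at hQ0
  have hχc : 1 - χ c ≠ 0 := by
    intro h0
    refine hc (MonoidAlgebra.of_injective (R := ℤ) ?_)
    rw [map_one]
    exact (sub_eq_zero.mp h0).symm
  exact eq_of_fox_eq (hθ x) (sub_eq_zero.mp ((smul_eq_zero.mp hQ0).resolve_left hχc))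

/-- An endomorphism with image in `H` is, on `H`, invertible once it is trivial on `H ∩ M'` and
modulo `H ∩ M'`; following it by this inverse gives a retraction. -/
lemma isGroupRetract_of_fixes (H : Subgroup (FreeMetabelianGroup r))
    (θ : FreeMetabelianGroup r →* H) (hθ : ∀ x : H, ab r (θ x) = ab r x)
    (hfix : ∀ x : H, ab r x = 1 → θ x = x) : IsGroupRetract H := by
  have hbij : Function.Bijective (θ.comp H.subtype) := by
    constructor
    · rw [injective_iff_map_eq_one]
      intro x hx
      have hx' : θ x = 1 := hx
      have h1 : ab r x = 1 := by rw [← hθ, hx', Subgroup.coe_one, map_one]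
      rw [← hfix x h1, hx']
    · intro x
      have h1 : ab r ((θ x)⁻¹ * x : H) = 1 := by
        rw [Subgroup.coe_mul, Subgroup.coe_inv, map_mul, map_inv, hθ, inv_mul_cancel]
      refine ⟨x * ((θ x)⁻¹ * x), ?_⟩
      rw [map_mul, MonoidHom.comp_apply, MonoidHom.comp_apply, Subgroup.subtype_apply,
        Subgroup.subtype_apply, hfix _ h1, mul_inv_cancel_left]
  refine ⟨(MulEquiv.ofBijective _ hbij).symm.toMonoidHom.comp θ, fun h => ?_⟩
  exact (MulEquiv.ofBijective _ hbij).symm_apply_apply h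

end FreeMetabelianGroup

/-! ### Linear forms dividing a monomial -/

section LinearForm

open MvPolynomial

/-- The linear form `∑ uᵢ Xᵢ` with rational coefficients `u`. -/
noncomputable def linearForm {ι : Type*} [Fintype ι] (u : ι → ℚ) : MvPolynomial ι ℚ :=
  ∑ i, C (u i) * X i

variable {ι : Type*} [Fintype ι]

lemma linearForm_add (u v : ι → ℚ) : linearForm (u + v) = linearForm u + linearForm v := by
  simp [linearForm, add_mul, Finset.sum_add_distrib]

variable [DecidableEq ι]

lemma linearForm_single (i : ι) (c : ℚ) : linearForm (Pi.single i c) = C c * X i := by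
  rw [linearForm, Finset.sum_eq_single i]
  · simp
  · intro j _ hj; simp [hj]
  · simp

lemma linearForm_injective : Function.Injective (linearForm (ι := ι)) := by
  intro u v h
  funext i
  have := congrArg (eval (Pi.single i 1)) h
  simpa [linearForm, Pi.single_apply] using this

lemma eq_single_of_linearForm_dvd {u : ι → ℚ} {i j : ι} {a b : ℕ}
    (h : linearForm u ∣ X i ^ a * X j ^ b) :
    (∃ c, u = Pi.single i c) ∨ ∃ c, u = Pi.single j c := by
  obtain ⟨p, q, hp, hq, hpq⟩ := exists_dvd_and_dvd_of_dvd_mul h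
  obtain ⟨k, -, hk⟩ := (dvd_prime_pow X_prime a).mp hp
  obtain ⟨n, -, hn⟩ := (dvd_prime_pow X_prime b).mp hq
  obtain ⟨e, he⟩ := (hk.mul_mul hn).symm
  obtain ⟨c, hc, hce⟩ := MvPolynomial.isUnit_iff_eq_C_of_isReduced.mp e.isUnit
  have heq : linearForm u = C c * (X i ^ k * X j ^ n) := by rw [hpq, ← he, hce]; ring
  have hc0 : c ≠ 0 := hc.ne_zero
  -- Comparing values at `(t, …, t)` shows that the monomial has degree one.
  have hdeg : ∀ t : ℚ, (∑ i, u i) * t = c * t ^ (k + n) := by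
    intro t
    have := congrArg (eval fun _ => t) heq
    simpa [linearForm, pow_add, Finset.sum_mul] using this
  have hkn : k + n = 1 := by
    have h1 := hdeg 1
    have h2 := hdeg 2
    rw [one_pow, mul_one, mul_one] at h1
    rw [h1] at h2
    have h3 : (2 : ℚ) ^ (k + n) = 2 ^ 1 := by
      rw [pow_one]; exact (mul_left_cancel₀ hc0 h2).symm
    exact Nat.pow_right_injective le_rfl (by exact_mod_cast h3)
  rcases Nat.add_eq_one_iff.mp hkn with ⟨rfl, rfl⟩ | ⟨rfl, rfl⟩
  · right
    refine ⟨c, linearForm_injective ?_⟩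
    rw [heq, linearForm_single]; ring
  · left
    refine ⟨c, linearForm_injective ?_⟩
    rw [heq, linearForm_single]; ring

/-- The identity is the `j`-th coordinate of `u² v (u ∧ v) = x² y (x ∧ y)`, where `x` and `y` are
the coordinate forms `Xᵢ` and `Xⱼ`. It determines the integral linear forms `u` and `v` up to
sign. -/
lemma linearForm_rigidity {u v : ι → ℤ} {i j : ι} (hij : i ≠ j)
    (hj : linearForm (fun n => (u n : ℚ)) ^ 2 * linearForm (fun n => (v n : ℚ)) *
        (C (v j : ℚ) * linearForm (fun n => (u n : ℚ)) -
          C (u j : ℚ) * linearForm (fun n => (v n : ℚ))) = X i ^ 3 * X j) :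
    (u = Pi.single i 1 ∨ u = -Pi.single i 1) ∧ (v = Pi.single j 1 ∨ v = -Pi.single j 1) := by
  have hXi : (X i : MvPolynomial ι ℚ) ≠ 0 := X_ne_zero i
  have hXj : (X j : MvPolynomial ι ℚ) ≠ 0 := X_ne_zero j
  -- `u` is proportional to `x`: it divides `x³ y`, and `y²` does not.
  obtain ⟨c, hc⟩ : ∃ c, (fun n => (u n : ℚ)) = Pi.single i c := by
    rcases eq_single_of_linearForm_dvd (u := fun n => (u n : ℚ)) (i := i) (j := j) (a := 3) (b := 1)
      ⟨linearForm (fun n => (u n : ℚ)) * linearForm (fun n => (v n : ℚ)) *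
        (C (v j : ℚ) * linearForm (fun n => (u n : ℚ)) -
          C (u j : ℚ) * linearForm (fun n => (v n : ℚ))), by linear_combination -hj⟩ with h1 | ⟨c, hc⟩
    · exact h1
    · exfalso
      rw [hc, linearForm_single] at hj
      have h2 : X j * (X j * (C c ^ 2 * linearForm (fun n => (v n : ℚ)) *
          (C (v j : ℚ) * (C c * X j) - C (u j : ℚ) * linearForm (fun n => (v n : ℚ))))) =
          X j * X i ^ 3 := by
        linear_combination hj
      have h3 : (X j : MvPolynomial ι ℚ) ∣ X i ^ 3 := ⟨_, (mul_left_cancel₀ hXj h2).symm⟩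
      exact hij ((X_dvd_X.mp (X_prime.dvd_of_dvd_pow h3)).symm)
  have huj : u j = 0 := by
    have := congrFun hc j
    rw [Pi.single_eq_of_ne hij.symm] at this
    exact_mod_cast this
  have hui : (u i : ℚ) = c := by simpa using congrFun hc i
  rw [huj, hc, linearForm_single] at hj
  simp only [Int.cast_zero, C_0, zero_mul, sub_zero] at hj
  obtain ⟨d, hd⟩ : ∃ d, (fun n => (v n : ℚ)) = Pi.single j d := by
    rcases eq_single_of_linearForm_dvd (u := fun n => (v n : ℚ)) (i := i) (j := j) (a := 3) (b := 1)
      ⟨(C c * X i) ^ 2 * (C (v j : ℚ) * (C c * X i)), by linear_combination -hj⟩ with ⟨d, hd⟩ | h1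
    · exfalso
      have hvj : (v j : ℚ) = 0 := by simpa [Pi.single_eq_of_ne hij.symm] using congrFun hd j
      rw [hvj] at hj
      simp [hXi, hXj] at hj
    · exact h1
  have hvj : (v j : ℚ) = d := by simpa using congrFun hd j
  rw [hd, linearForm_single, hvj] at hj
  have hcd : (u i) ^ 3 * (v j) ^ 2 = 1 := by
    have := congrArg (eval fun _ => (1 : ℚ)) hj
    simp only [map_mul, map_pow, eval_C, eval_X] at this
    rw [← hui, ← hvj] at this
    have h4 : ((u i : ℚ)) ^ 3 * (v j : ℚ) ^ 2 = 1 := by linear_combination this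
    exact_mod_cast h4
  have hu : u = Pi.single i (u i) := by
    funext n
    have h5 := congrFun hc n
    rcases eq_or_ne n i with rfl | hn
    · simp
    · rw [Pi.single_eq_of_ne hn] at h5 ⊢
      exact_mod_cast h5
  have hv : v = Pi.single j (v j) := by
    funext n
    have h5 := congrFun hd n
    rcases eq_or_ne n j with rfl | hn
    · simp
    · rw [Pi.single_eq_of_ne hn] at h5 ⊢
      exact_mod_cast h5
  have hui' := Int.isUnit_iff.mp ((isUnit_pow_iff three_ne_zero).mp (IsUnit.of_mul_eq_one _ hcd))
  have hvj' := Int.isUnit_iff.mp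
    ((isUnit_pow_iff two_ne_zero).mp (IsUnit.of_mul_eq_one _ ((mul_comm _ _).trans hcd)))
  refine ⟨?_, ?_⟩
  · rcases hui' with h6 | h6 <;> rw [hu, h6] <;> simp [Pi.single_neg]
  · rcases hvj' with h6 | h6 <;> rw [hv, h6] <;> simp [Pi.single_neg]

end LinearForm

/-! ### Leading forms of Fox derivatives -/

namespace FreeMetabelianGroup

variable {r : ℕ} {ι : Type*} [Fintype ι] (π : (Fin r → ℤ) →+ (ι → ℚ))

/-- The character `a ↦ exp (t ℓ(a))` of `ℤ^r`, where `ℓ(a)` is the linear form with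
coefficients `π a`. -/
noncomputable def expChar : FreeAb r →* PowerSeries (MvPolynomial ι ℚ) where
  toFun a := PowerSeries.rescale (linearForm (π a.toAdd)) (PowerSeries.exp _)
  map_one' := by
    rw [toAdd_one, map_zero]
    simp [linearForm]
  map_mul' a b := by
    rw [PowerSeries.exp_mul_exp_eq_exp_add, ← linearForm_add, ← map_add, toAdd_mul]

/-- The `k`-th coordinate, under `π`, of the vector of Fox derivatives, expanded as a power series
in `t` through `expChar π`. -/
noncomputable def foxSeries (k : ι) (m : FreeMetabelianGroup r) :
    PowerSeries (MvPolynomial ι ℚ) :=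
  ∑ i, PowerSeries.C (MvPolynomial.C (π (Pi.single i 1) k)) *
    MonoidAlgebra.lift ℤ _ (FreeAb r) (expChar π) (fox m i)

lemma isCrossedHom_foxSeries (k : ι) :
    IsCrossedHom ((expChar π).comp (ab r)) (foxSeries π k) := by
  intro g h
  have e : ∀ i, MonoidAlgebra.lift ℤ _ (FreeAb r) (expChar π) (fox (g * h) i) =
      MonoidAlgebra.lift ℤ _ (FreeAb r) (expChar π) (fox g i) +
        expChar π (ab r g) * MonoidAlgebra.lift ℤ _ (FreeAb r) (expChar π) (fox h i) := by
    intro i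
    rw [isCrossedHom_fox g h, Pi.add_apply, Pi.smul_apply, smul_eq_mul, map_add, map_mul,
      MonoidHom.comp_apply, MonoidAlgebra.lift_of]
  simp only [foxSeries, e]
  rw [smul_eq_mul, Finset.mul_sum, ← Finset.sum_add_distrib]
  refine Finset.sum_congr rfl fun i _ => ?_
  rw [mul_add, mul_left_comm, MonoidHom.comp_apply]

lemma constantCoeff_expChar (a : FreeAb r) : PowerSeries.constantCoeff (expChar π a) = 1 := by
  rw [← PowerSeries.coeff_zero_eq_constantCoeff_apply]
  simp [expChar]

lemma exists_expChar_eq (a : FreeAb r) : ∃ q, expChar π a = 1 + PowerSeries.X * q ∧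
    PowerSeries.constantCoeff q = linearForm (π a.toAdd) := by
  obtain ⟨q, hq⟩ := PowerSeries.X_dvd_iff.mpr
    (show PowerSeries.constantCoeff (expChar π a - 1) = 0 by
      rw [map_sub, constantCoeff_expChar, map_one, sub_self])
  refine ⟨q, by rw [← hq]; ring, ?_⟩
  have h := congrArg (PowerSeries.coeff 1) hq
  rw [PowerSeries.coeff_succ_X_mul, PowerSeries.coeff_zero_eq_constantCoeff_apply] at h
  rw [← h]
  simp [expChar, PowerSeries.coeff_one]

lemma constantCoeff_foxSeries (k : ι) (m : FreeMetabelianGroup r) :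
    PowerSeries.constantCoeff (foxSeries π k m) = MvPolynomial.C (π (ab r m).toAdd k) := by
  let f₁ : FreeMetabelianGroup r →* Multiplicative (MvPolynomial ι ℚ) :=
    { toFun := fun m => Multiplicative.ofAdd (PowerSeries.constantCoeff (foxSeries π k m))
      map_one' := by rw [(isCrossedHom_foxSeries π k).map_one, map_zero, ofAdd_zero]
      map_mul' := fun x y => by
        rw [isCrossedHom_foxSeries π k x y, map_add, smul_eq_mul, map_mul, MonoidHom.comp_apply,
          constantCoeff_expChar, one_mul, ofAdd_add] }
  let f₂ : FreeMetabelianGroup r →* Multiplicative (MvPolynomial ι ℚ) :=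
    { toFun := fun m => Multiplicative.ofAdd (MvPolynomial.C (π (ab r m).toAdd k))
      map_one' := by simp
      map_mul' := fun x y => by simp }
  have h : f₁ = f₂ := by
    refine MonoidHom.eq_of_eqOn_dense closure_range_gen ?_
    rintro _ ⟨i, rfl⟩
    refine congrArg Multiplicative.ofAdd ?_
    rw [ab_gen, foxSeries, fox_gen, Finset.sum_eq_single i]
    · simp
    · intro j _ hj; simp [hj]
    · simp
  exact congrArg Multiplicative.toAdd (DFunLike.congr_fun h m)

/-- The Fox derivatives of `⁅⁅⁅⁅u, v⁆, u⁆, u⁆, v⁆` start in degree `4`; `constantCoeff f` is their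
coefficient there. -/
lemma foxSeries_iterated_commutator (k : ι) (u v : FreeMetabelianGroup r) :
    ∃ f, foxSeries π k ⁅⁅⁅⁅u, v⁆, u⁆, u⁆, v⁆ = PowerSeries.X ^ 4 * f ∧
      PowerSeries.constantCoeff f =
        -(linearForm (π (ab r u).toAdd) ^ 2 * linearForm (π (ab r v).toAdd) *
          (MvPolynomial.C (π (ab r v).toAdd k) * linearForm (π (ab r u).toAdd) -
            MvPolynomial.C (π (ab r u).toAdd k) * linearForm (π (ab r v).toAdd))) := by
  obtain ⟨p, hp, hp'⟩ := exists_expChar_eq π (ab r u)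
  obtain ⟨q, hq, hq'⟩ := exists_expChar_eq π (ab r v)
  refine ⟨-(p ^ 2 * q * (foxSeries π k v * p - foxSeries π k u * q)), ?_, ?_⟩
  · rw [(isCrossedHom_foxSeries π k).map_iterated_commutator,
      (isCrossedHom_foxSeries π k).map_commutator]
    simp only [MonoidHom.comp_apply, hp, hq, smul_eq_mul]
    ring
  · simp only [map_neg, map_mul, map_sub, map_pow, hp', hq', constantCoeff_foxSeries]

/-- An endomorphism that fixes `⁅⁅⁅⁅hᵢ, hⱼ⁆, hᵢ⁆, hᵢ⁆, hⱼ⁆` acts as `±1` on the classes of `hᵢ` and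
`hⱼ`, provided it preserves the lattice spanned by the family `h`. -/
lemma ab_eq_or_eq_inv_of_fixes [DecidableEq ι] (h : ι → FreeMetabelianGroup r)
    (hπ : ∀ i, π (ab r (h i)).toAdd = Pi.single i 1)
    (φ : FreeMetabelianGroup r →* FreeMetabelianGroup r)
    (hs : ∀ i, ∃ s : ι → ℤ, ab r (φ (h i)) = ∏ k, ab r (h k) ^ s k) {i j : ι} (hij : i ≠ j)
    (hfix : φ ⁅⁅⁅⁅h i, h j⁆, h i⁆, h i⁆, h j⁆ = ⁅⁅⁅⁅h i, h j⁆, h i⁆, h i⁆, h j⁆) :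
    (ab r (φ (h i)) = ab r (h i) ∨ ab r (φ (h i)) = (ab r (h i))⁻¹) ∧
      (ab r (φ (h j)) = ab r (h j) ∨ ab r (φ (h j)) = (ab r (h j))⁻¹) := by
  choose s hs using hs
  have hπs : ∀ i, π (ab r (φ (h i))).toAdd = fun k => (s i k : ℚ) := by
    intro i
    rw [hs, toAdd_prod, map_sum]
    funext k
    simp only [toAdd_zpow, map_zsmul, hπ]
    simp [Finset.sum_apply, Pi.single_apply]
  have hrig := linearForm_rigidity (u := s i) (v := s j) hij (by
    obtain ⟨f, hf, hf'⟩ := foxSeries_iterated_commutator π j (φ (h i)) (φ (h j))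
    obtain ⟨g, hg, hg'⟩ := foxSeries_iterated_commutator π j (h i) (h j)
    simp only [map_commutatorElement] at hfix
    rw [hfix, hg] at hf
    rw [← PowerSeries.X_pow_mul_cancel hf, hg'] at hf'
    simp only [hπs, hπ, linearForm_single, MvPolynomial.C_1, one_mul, Pi.single_eq_same,
      Pi.single_eq_of_ne hij.symm, MvPolynomial.C_0, zero_mul, sub_zero] at hf'
    rw [← neg_injective hf']
    ring)
  have hprod : ∀ i n, (s n = Pi.single i 1 ∨ s n = -Pi.single i 1) →
      (ab r (φ (h n)) = ab r (h i) ∨ ab r (φ (h n)) = (ab r (h i))⁻¹) := by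
    rintro i n (hn | hn)
    · left
      rw [hs, hn, Finset.prod_eq_single i] <;> simp +contextual
    · right
      rw [hs, hn, Finset.prod_eq_single i] <;> simp +contextual
  exact ⟨hprod i i hrig.1, hprod j j hrig.2⟩

/-! ### A basis of the image of a subgroup in the abelianization -/

lemma abelianization_lift_ab_injective :
    Function.Injective (Abelianization.lift (ab r)) := by
  rw [injective_iff_map_eq_one]
  intro x
  induction x using QuotientGroup.induction_on with
  | H m =>
    intro hm
    have : ab r m = 1 := hm
    rw [ab_eq_one_iff, ← Abelianization.ker_of] at this
    exact this

/-- Some elements of `H` map to a `ℤ`-basis of the image of `H` in `ℤ^r`. -/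
lemma exists_basis (H : Subgroup (FreeMetabelianGroup r)) [Group.FG H] {n : ℕ} (hn : rAb H = n) :
    ∃ h : Fin n → H, LinearIndependent ℤ (fun i => (ab r (h i)).toAdd) ∧
      ∀ x : H, ∃ s : Fin n → ℤ, ab r x = ∏ k, ab r (h k) ^ s k := by
  subst hn
  let j : Additive (abImage H) →+ (Fin r → ℤ) :=
    AddMonoidHom.toMultiplicative.symm ((Abelianization.lift (ab r)).comp (abImage H).subtype)
  have hj : Function.Injective j :=
    abelianization_lift_ab_injective.comp (abImage H).subtype_injective
  have : Module.Finite ℤ (Additive (abImage H)) :=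
    Module.Finite.iff_addGroup_fg.mpr inferInstance
  have : Module.IsTorsionFree ℤ (Additive (abImage H)) :=
    hj.moduleIsTorsionFree j fun n x => map_zsmul j n x
  have : Module.Free ℤ (Additive (abImage H)) := Module.free_of_finite_type_torsion_free'
  have hclos : ∀ S : Set (abImage H), Submodule.span ℤ (Additive.toMul ⁻¹' S) = ⊤ ↔
      Subgroup.closure S = ⊤ := by
    intro S
    rw [← Submodule.toAddSubgroup_inj, Submodule.span_int_eq_addSubgroupClosure,
      ← Subgroup.toAddSubgroup_closure, Submodule.top_toAddSubgroup]
    exact Subgroup.toAddSubgroup.injective.eq_iff' rfl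
  have hrank : Module.finrank ℤ (Additive (abImage H)) = rAb H := by
    apply le_antisymm
    · obtain ⟨S, hS, hS'⟩ := Group.rank_spec (abImage H)
      rw [rAb, ← hS]
      have := finrank_le_of_span_eq_top (R := ℤ) (v := fun x : S => Additive.ofMul (x : abImage H))
        (by
          rw [← (hclos _).mpr hS']
          congr 1
          ext x
          exact ⟨by rintro ⟨y, rfl⟩; exact y.2, fun hx => ⟨⟨x.toMul, hx⟩, rfl⟩⟩)
      simpa using this
    · classical
      let b := Module.finBasis ℤ (Additive (abImage H))
      have hb := Group.rank_le (S := Finset.univ.image fun i => (b i).toMul) (by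
        rw [← hclos, ← b.span_eq]
        congr 1
        ext x
        simp)
      refine hb.trans (Finset.card_image_le.trans ?_)
      simp
  let b := Module.finBasisOfFinrankEq ℤ (Additive (abImage H)) hrank
  have hlift : ∀ i, ∃ x : H, Abelianization.of (x : FreeMetabelianGroup r) = (b i).toMul := by
    intro i
    obtain ⟨x, hx, hx'⟩ := (b i).toMul.2
    exact ⟨⟨x, hx⟩, hx'⟩
  choose h hh using hlift
  have hjb : ∀ i, (ab r (h i)).toAdd = j (b i) := by
    intro i
    change _ = (Abelianization.lift (ab r) ((b i).toMul : Abelianization _)).toAdd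
    rw [← hh]
    rfl
  refine ⟨h, ?_, fun x => ?_⟩
  · simp only [hjb]
    exact b.linearIndependent.map' j.toIntLinearMap (LinearMap.ker_eq_bot.mpr hj)
  · let y : abImage H := ⟨Abelianization.of (x : FreeMetabelianGroup r), x, x.2, rfl⟩
    refine ⟨b.repr (Additive.ofMul y), ?_⟩
    have h1 : j (Additive.ofMul y) = (ab r x).toAdd := rfl
    rw [← b.sum_repr (Additive.ofMul y), map_sum] at h1
    refine Multiplicative.toAdd.injective ?_
    rw [← h1, toAdd_prod]
    refine Finset.sum_congr rfl fun k _ => ?_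
    rw [toAdd_zpow, hjb, map_zsmul]

/-- The image of `H` need not be a direct summand of `ℤ^r`, so the dual family is rational. -/
lemma exists_dual_of_linearIndependent {n : ℕ} {v : Fin n → Fin r → ℤ}
    (hv : LinearIndependent ℤ v) : ∃ π : (Fin r → ℤ) →+ (Fin n → ℚ), ∀ i, π (v i) = Pi.single i 1 := by
  let c : (Fin r → ℤ) →ₗ[ℤ] (Fin r → ℚ) :=
    LinearMap.pi fun i => (Algebra.linearMap ℤ ℚ).comp (LinearMap.proj i)
  have hc : Function.Injective c := by
    intro x y hxy
    funext i
    exact Int.cast_injective (α := ℚ) (congrFun hxy i)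
  have hcv : LinearIndependent ℚ (c ∘ v) :=
    (LinearIndependent.iff_fractionRing ℤ ℚ).mp (hv.map' c (LinearMap.ker_eq_bot.mpr hc))
  obtain ⟨g, hg⟩ := (Fintype.linearCombination ℚ (c ∘ v)).exists_leftInverse_of_injective
    (LinearMap.ker_eq_bot.mpr hcv.fintypeLinearCombination_injective)
  refine ⟨(g.toAddMonoidHom).comp c.toAddMonoidHom, fun i => ?_⟩
  have := LinearMap.congr_fun hg (Pi.single i 1)
  simpa [Fintype.linearCombination_apply_single] using this

end FreeMetabelianGroup

/-! ### Verbally closed subgroups -/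

namespace FreeMetabelianGroup

variable {r : ℕ}

/-- A homomorphism from `M_r` to a subgroup of `M_r` may be prescribed on the generators. -/
lemma exists_hom (H : Subgroup (FreeMetabelianGroup r)) (y : Fin r → H) :
    ∃ φ : FreeMetabelianGroup r →* H,
      ∀ w : FreeGroup (Fin r), φ (QuotientGroup.mk w) = FreeGroup.lift y w := by
  have hH : derivedSeries H 2 = ⊥ := by
    have h := map_derivedSeries_le_derivedSeries H.subtype 2
    rw [derivedSeries_two_eq_bot, le_bot_iff] at h
    exact (Subgroup.map_eq_bot_iff_of_injective _ H.subtype_injective).mp h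
  refine ⟨QuotientGroup.lift _ (FreeGroup.lift y) ?_, fun w => rfl⟩
  intro w hw
  have h := map_derivedSeries_le_derivedSeries (FreeGroup.lift y) 2 (Subgroup.mem_map_of_mem _ hw)
  rwa [hH] at h

lemma lift_mk_of (w : FreeGroup (Fin r)) :
    FreeGroup.lift (fun i => gen (r := r) i) w = QuotientGroup.mk w := by
  have : FreeGroup.lift (fun i => gen (r := r) i) =
      QuotientGroup.mk' (derivedSeries (FreeGroup (Fin r)) 2) :=
    FreeGroup.ext_hom _ _ fun i => FreeGroup.lift_apply_of
  rw [this]; rfl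

/-- Verbal closedness yields an endomorphism with image in `H` that fixes `l` given elements. -/
lemma exists_hom_fixing {l : ℕ} {H : Subgroup (FreeMetabelianGroup r)}
    (hclosed : IsLVerballyClosed l H) (g : Fin l → H) :
    ∃ φ : FreeMetabelianGroup r →* H, ∀ i, φ (g i) = g i := by
  choose w hw using fun i => QuotientGroup.mk_surjective (g i : FreeMetabelianGroup r)
  obtain ⟨y, hy⟩ := hclosed r w g ⟨fun i => gen i, fun i => by rw [lift_mk_of, hw]⟩
  obtain ⟨φ, hφ⟩ := exists_hom H y
  exact ⟨φ, fun i => by rw [← hw, hφ, hy]⟩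

/-- `H ∩ M' = H'`: a homomorphism from `M` to `H` fixing an element of `H ∩ M'` exhibits it as an
element of `H'`. -/
lemma mem_commutator_of_isLVerballyClosed {l : ℕ} (hl : 1 ≤ l)
    {H : Subgroup (FreeMetabelianGroup r)} (hclosed : IsLVerballyClosed l H) (x : H)
    (hx : ab r x = 1) : x ∈ commutator H := by
  obtain ⟨φ, hφ⟩ := exists_hom_fixing hclosed fun _ => x
  rw [← hφ ⟨0, hl⟩]
  have h := Subgroup.mem_map_of_mem φ (ab_eq_one_iff.mp hx)
  rw [commutator_def, Subgroup.map_commutator] at h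
  exact Subgroup.commutator_mono le_top le_top h

lemma ab_map_eq_of_ab_eq (φ : FreeMetabelianGroup r →* FreeMetabelianGroup r)
    {x y : FreeMetabelianGroup r} (h : ab r x = ab r y) : ab r (φ x) = ab r (φ y) := by
  have h1 : x⁻¹ * y ∈ commutator (FreeMetabelianGroup r) := by
    rw [← ab_eq_one_iff, map_mul, map_inv, h, inv_mul_cancel]
  have h2 : (ab r).comp φ (x⁻¹ * y) = 1 := Abelianization.commutator_subset_ker _ h1
  rw [map_mul, map_inv, inv_mul_eq_one] at h2
  exact h2

lemma exists_mem_closure_ab_eq {ι : Type*} [Fintype ι] {H : Subgroup (FreeMetabelianGroup r)}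
    (h : ι → H) {x : FreeMetabelianGroup r} {s : ι → ℤ} (hs : ab r x = ∏ k, ab r (h k) ^ s k) :
    ∃ k ∈ Subgroup.closure (Set.range h), ab r k = ab r x := by
  have : ab r x ∈ (Subgroup.closure (Set.range h)).map ((ab r).comp H.subtype) := by
    rw [hs]
    refine Subgroup.prod_mem _ fun k _ => Subgroup.zpow_mem _ ?_ _
    exact ⟨h k, Subgroup.subset_closure ⟨k, rfl⟩, rfl⟩
  obtain ⟨k, hk, hkx⟩ := this
  exact ⟨k, hk, hkx⟩

/-- Since `Λ` is a domain, the scalar `(1 - c) (1 - u) ^ 2` relating the derivatives of the iterated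
commutator to those of `⁅u, c⁆` can be cancelled. -/
lemma fox_commutator_eq_of_fixes {u c : FreeMetabelianGroup r}
    (θ : FreeMetabelianGroup r →* FreeMetabelianGroup r)
    (hu : ab r (θ u) = ab r u) (hc : ab r (θ c) = ab r c) (hu1 : ab r u ≠ 1) (hc1 : ab r c ≠ 1)
    (hfix : θ ⁅⁅⁅⁅u, c⁆, u⁆, u⁆, c⁆ = ⁅⁅⁅⁅u, c⁆, u⁆, u⁆, c⁆) : fox (θ ⁅u, c⁆) = fox ⁅u, c⁆ := by
  have h1 := congrArg fox hfix
  simp only [map_commutatorElement] at h1 ⊢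
  rw [isCrossedHom_fox.map_iterated_commutator, isCrossedHom_fox.map_iterated_commutator] at h1
  simp only [MonoidHom.comp_apply, hu, hc] at h1
  have hne : ∀ a : FreeAb r, a ≠ 1 → 1 - MonoidAlgebra.of ℤ _ a ≠ 0 := by
    intro a ha h0
    refine ha (MonoidAlgebra.of_injective (R := ℤ) ?_)
    rw [map_one]
    exact (sub_eq_zero.mp h0).symm
  exact smul_right_injective _ (mul_ne_zero (hne _ hc1) (pow_ne_zero 2 (hne _ hu1))) h1

end FreeMetabelianGroup

open FreeMetabelianGroup in
theorem theorem4 (l : ℕ) (hl : 1 ≤ l) (r : ℕ) (H : Subgroup (FreeMetabelianGroup r))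
    [Group.FG H] (hclosed : IsLVerballyClosed l H) (hrank : rAb H = l + 1) :
    IsGroupRetract H := by
  obtain ⟨h, hind, hspan⟩ := exists_basis H hrank
  obtain ⟨π, hπ⟩ := exists_dual_of_linearIndependent hind
  obtain ⟨φ, hφ⟩ := exists_hom_fixing hclosed fun i : Fin l =>
    ⁅⁅⁅⁅h i.castSucc, h (Fin.last l)⁆, h i.castSucc⁆, h i.castSucc⁆, h (Fin.last l)⁆
  let φM : FreeMetabelianGroup r →* FreeMetabelianGroup r := H.subtype.comp φ
  have hφM : ∀ i : Fin l, φM ⁅⁅⁅⁅(h i.castSucc).1, (h (Fin.last l)).1⁆, (h i.castSucc).1⁆,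
      (h i.castSucc).1⁆, (h (Fin.last l)).1⁆ = ⁅⁅⁅⁅(h i.castSucc).1, (h (Fin.last l)).1⁆,
      (h i.castSucc).1⁆, (h i.castSucc).1⁆, (h (Fin.last l)).1⁆ :=
    fun i => congrArg Subtype.val (hφ i)
  have hsign := fun i : Fin l => ab_eq_or_eq_inv_of_fixes π (fun n => (h n).1) hπ φM
    (fun n => hspan (φ (h n).1)) (Fin.castSucc_lt_last i).ne (hφM i)
  have hsq : ∀ i, ab r (φM (φM (h i))) = ab r (h i) := by
    have key : ∀ x : FreeMetabelianGroup r, (ab r (φM x) = ab r x ∨ ab r (φM x) = (ab r x)⁻¹) →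
        ab r (φM (φM x)) = ab r x := by
      rintro x (hx | hx)
      · rw [ab_map_eq_of_ab_eq φM hx, hx]
      · rw [← map_inv] at hx
        rw [ab_map_eq_of_ab_eq φM hx, map_inv, map_inv, hx, map_inv, inv_inv]
    intro i
    induction i using Fin.lastCases with
    | last => exact key _ (hsign ⟨0, hl⟩).2
    | cast i => exact key _ (hsign i).1
  have hθ : ∀ x : H, ab r (φM (φM x)) = ab r x := by
    intro x
    obtain ⟨s, hs⟩ := hspan x
    obtain ⟨k, hk, hkx⟩ := exists_mem_closure_ab_eq h hs
    rw [ab_map_eq_of_ab_eq φM (ab_map_eq_of_ab_eq φM hkx.symm), ← hkx]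
    refine MonoidHom.eqOn_closure (f := (ab r).comp ((φM.comp φM).comp H.subtype))
      (g := (ab r).comp H.subtype) ?_ hk
    rintro _ ⟨i, rfl⟩
    exact hsq i
  have hne : ∀ i, ab r (h i) ≠ 1 := by
    intro i hi
    refine hind.ne_zero i ?_
    simp only [hi, toAdd_one]
  refine isGroupRetract_of_fixes H (φ.comp (H.subtype.comp φ)) hθ fun x hx => Subtype.ext ?_
  refine fixes_of_fixes_commutators H (mem_commutator_of_isLVerballyClosed hl hclosed)
    (Set.range h) (h (Fin.last l)) ?_ (hne _) (φM.comp φM) hθ ?_ x hx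
  · intro x
    obtain ⟨s, hs⟩ := hspan x
    exact exists_mem_closure_ab_eq h hs
  · rintro _ ⟨i, rfl⟩
    induction i using Fin.lastCases with
    | last => simp
    | cast i =>
      refine fox_commutator_eq_of_fixes (φM.comp φM) (hθ _) (hθ _) (hne _) (hne _) ?_
      rw [MonoidHom.comp_apply, hφM, hφM]
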